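/- Let $H$ be a complex Hilbert space and let $A \subseteq B(H)$ be a Jordan operator algebra, that is, a norm-closed linear subspace that is closed under the Jordan product $a \circ b = \frac12(ab+ba)$ ($A$ need not have an identity or an approximate identity). For a linear subspace $S \subseteq B(H)$ write $\Delta(S) = S \cap S^* = \{x \in S : x^* \in S\}$. Let $P : A \to A$ be a linear map with $P \circ P = P$ and $\|P(x)\| \le \|x\|$ for all $x \in A$, which is real positive: if $x \in A$ and $\frac12(x + x^*) \ge 0$, then $\frac12(P(x) + P(x)^*) \ge 0$. Then $\Delta(A)$ is a $JC^*$-algebra (a Jordan operator algebra closed under the involution of $B(H)$), the restriction of $P$ to $\Delta(A)$ is positive, that is, $P(x) \ge 0$ for every $x \in \Delta(A)$ with $x \ge 0$, and $$P(\Delta(A)) = \Delta(P(A)) = \Delta(A) \cap P(A).$$ -/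

import Mathlib

namespace JordanOA

variable {H : Type*} [NormedAddCommGroup H] [InnerProductSpace ℂ H] [CompleteSpace H]

/-- The Jordan product `a ∘ b = (ab + ba) / 2` on `B(H)`. -/
noncomputable def jordanProduct (a b : H →L[ℂ] H) : H →L[ℂ] H :=
  (2⁻¹ : ℂ) • (a * b + b * a)

/-- A Jordan operator algebra on `H`: a norm-closed linear subspace of `B(H)` which is closed
under the Jordan product. No identity or approximate identity is required. -/
structure IsJordanOperatorAlgebra (A : Submodule ℂ (H →L[ℂ] H)) : Prop where
  isClosed : IsClosed (A : Set (H →L[ℂ] H))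
  jordanProduct_mem : ∀ a ∈ A, ∀ b ∈ A, jordanProduct a b ∈ A

/-- A `JC*`-algebra on `H`: a Jordan operator algebra which is closed under the involution
of `B(H)`. -/
structure IsJCStarAlgebra (A : Submodule ℂ (H →L[ℂ] H)) : Prop
    extends IsJordanOperatorAlgebra A where
  star_mem : ∀ a ∈ A, star a ∈ A

/-- The diagonal `Δ(S) = S ∩ S*` of a linear subspace `S` of `B(H)`. -/
def diagonal (S : Submodule ℂ (H →L[ℂ] H)) : Submodule ℂ (H →L[ℂ] H) where
  carrier := {x | x ∈ S ∧ star x ∈ S}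
  add_mem' := fun {x y} hx hy => ⟨S.add_mem hx.1 hy.1, by
    rw [star_add]; exact S.add_mem hx.2 hy.2⟩
  zero_mem' := ⟨S.zero_mem, by rw [star_zero]; exact S.zero_mem⟩
  smul_mem' := fun c x hx => ⟨S.smul_mem c hx.1, by
    rw [star_smul]; exact S.smul_mem (star c) hx.2⟩

/-- An operator `T` is real positive (accretive) if its real part `(T + T*) / 2` is a positive
operator. -/
def IsRealPositive (T : H →L[ℂ] H) : Prop :=
  ((2⁻¹ : ℂ) • (T + star T)).IsPositive

/-- A linear map `P : A → A` is real positive if it maps the real positive elements of `A` to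
real positive elements. -/
def IsRealPositiveMap {A : Submodule ℂ (H →L[ℂ] H)} (P : A →ₗ[ℂ] A) : Prop :=
  ∀ x : A, IsRealPositive (x : H →L[ℂ] H) → IsRealPositive (P x : H →L[ℂ] H)

/-- The image `P(S) = {P x : x ∈ A ∩ S}`, as a linear subspace of `B(H)`. For `S ≤ A` this is
the usual image of `S`. -/
def image {A : Submodule ℂ (H →L[ℂ] H)} (P : A →ₗ[ℂ] A) (S : Submodule ℂ (H →L[ℂ] H)) :
    Submodule ℂ (H →L[ℂ] H) :=
  (S.comap A.subtype).map (A.subtype ∘ₗ P)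

end JordanOA

/-!
An operator `T` is skew-adjoint exactly when both `T` and `-T` are real positive. Hence a real
positive linear map preserves skew-adjointness and, being complex linear, commutes with the
involution wherever the latter stays inside its domain. Positivity on the diagonal and
`P(Δ(A)) ⊆ Δ(P(A))` follow from this; idempotence then closes the cycle
`P(Δ(A)) ⊆ Δ(P(A)) ⊆ Δ(A) ∩ P(A) ⊆ P(Δ(A))`.
-/

namespace JordanOA

variable {H : Type*} [NormedAddCommGroup H] [InnerProductSpace ℂ H]

section Image

variable {A : Submodule ℂ (H →L[ℂ] H)} {P : A →ₗ[ℂ] A} {S T : Submodule ℂ (H →L[ℂ] H)}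

lemma mem_image {y : H →L[ℂ] H} :
    y ∈ image P S ↔ ∃ a : A, (a : H →L[ℂ] H) ∈ S ∧ (P a : H →L[ℂ] H) = y :=
  Iff.rfl

lemma apply_mem_image_self (x : A) : (P x : H →L[ℂ] H) ∈ image P A :=
  mem_image.2 ⟨x, x.2, rfl⟩

lemma image_le : image P S ≤ A := by
  rintro _ ⟨a, -, rfl⟩
  exact (P a).2

lemma inf_image_le_image (hproj : ∀ x : A, P (P x) = P x) : S ⊓ image P T ≤ image P S := by
  rintro _ ⟨hS, a, -, rfl⟩
  exact mem_image.2 ⟨P a, hS, congrArg Subtype.val (hproj a)⟩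

end Image

variable [CompleteSpace H]

section Diagonal

variable {S T : Submodule ℂ (H →L[ℂ] H)}

lemma diagonal_le : diagonal S ≤ S := fun _ hx => hx.1

lemma diagonal_mono (h : S ≤ T) : diagonal S ≤ diagonal T := fun _ hx => ⟨h hx.1, h hx.2⟩

lemma star_jordanProduct (a b : H →L[ℂ] H) :
    star (jordanProduct a b) = jordanProduct (star a) (star b) := by
  simp [jordanProduct, add_comm]

lemma IsJordanOperatorAlgebra.isJCStarAlgebra_diagonal (hS : IsJordanOperatorAlgebra S) :
    IsJCStarAlgebra (diagonal S) where
  isClosed := hS.isClosed.inter (hS.isClosed.preimage continuous_star)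
  jordanProduct_mem a ha b hb :=
    ⟨hS.jordanProduct_mem a ha.1 b hb.1,
      star_jordanProduct a b ▸ hS.jordanProduct_mem _ ha.2 _ hb.2⟩
  star_mem a ha := ⟨ha.2, (star_star a).symm ▸ ha.1⟩

end Diagonal

lemma isRealPositive_iff_isPositive {T : H →L[ℂ] H} (hT : IsSelfAdjoint T) :
    IsRealPositive T ↔ T.IsPositive := by
  have real_part : (2⁻¹ : ℂ) • (T + star T) = T := by
    rw [hT.star_eq]
    module
  rw [IsRealPositive, real_part]

lemma mem_skewAdjoint_iff_isRealPositive {T : H →L[ℂ] H} :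
    T ∈ skewAdjoint (H →L[ℂ] H) ↔ IsRealPositive T ∧ IsRealPositive (-T) := by
  have real_part_neg : (2⁻¹ : ℂ) • (-T + star (-T)) = -((2⁻¹ : ℂ) • (T + star T)) := by
    rw [star_neg]
    module
  rw [skewAdjoint.mem_iff, IsRealPositive, IsRealPositive, real_part_neg,
    ← ContinuousLinearMap.nonneg_iff_isPositive, ← ContinuousLinearMap.nonneg_iff_isPositive,
    neg_nonneg, and_comm, ← le_antisymm_iff, smul_eq_zero_iff_right (by norm_num),
    eq_neg_iff_add_eq_zero, add_comm]

namespace IsRealPositiveMap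

variable {A : Submodule ℂ (H →L[ℂ] H)} {P : A →ₗ[ℂ] A}

lemma apply_mem_skewAdjoint (hP : IsRealPositiveMap P) {x : A}
    (hx : (x : H →L[ℂ] H) ∈ skewAdjoint (H →L[ℂ] H)) :
    (P x : H →L[ℂ] H) ∈ skewAdjoint (H →L[ℂ] H) := by
  rw [mem_skewAdjoint_iff_isRealPositive] at hx ⊢
  exact ⟨hP x hx.1, by simpa only [map_neg, Submodule.coe_neg] using hP (-x) hx.2⟩

lemma isSelfAdjoint_apply (hP : IsRealPositiveMap P) {x : A}
    (hx : IsSelfAdjoint (x : H →L[ℂ] H)) : IsSelfAdjoint (P x : H →L[ℂ] H) := by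
  have skew : ((Complex.I • x : A) : H →L[ℂ] H) ∈ skewAdjoint (H →L[ℂ] H) := by
    simp [skewAdjoint.mem_iff, hx.star_eq]
  have skew_apply := hP.apply_mem_skewAdjoint skew
  simpa [skewAdjoint.mem_iff, isSelfAdjoint_iff] using skew_apply

lemma isPositive_apply (hP : IsRealPositiveMap P) {x : A}
    (hx : (x : H →L[ℂ] H).IsPositive) : (P x : H →L[ℂ] H).IsPositive :=
  (isRealPositive_iff_isPositive (hP.isSelfAdjoint_apply hx.isSelfAdjoint)).1
    (hP x ((isRealPositive_iff_isPositive hx.isSelfAdjoint).2 hx))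

lemma apply_star (hP : IsRealPositiveMap P) (x : A) (hx : star (x : H →L[ℂ] H) ∈ A) :
    (P ⟨star x, hx⟩ : H →L[ℂ] H) = star (P x : H →L[ℂ] H) := by
  set y : A := ⟨star x, hx⟩
  have star_sum : star (P x + P y : H →L[ℂ] H) = P x + P y := by
    simpa only [map_add, Submodule.coe_add] using
      (hP.isSelfAdjoint_apply (x := x + y) (IsSelfAdjoint.add_star_self _)).star_eq
  have star_diff : star (P x - P y : H →L[ℂ] H) = -(P x - P y) := by
    have skew : ((x - y : A) : H →L[ℂ] H) ∈ skewAdjoint (H →L[ℂ] H) := by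
      simp [skewAdjoint.mem_iff, y]
    simpa only [map_sub, Submodule.coe_sub, skewAdjoint.mem_iff] using
      hP.apply_mem_skewAdjoint skew
  rw [star_add] at star_sum
  rw [star_sub] at star_diff
  linear_combination (norm := module) (-(2⁻¹ : ℂ)) • (star_sum + star_diff)

lemma image_diagonal_le_diagonal_image (hP : IsRealPositiveMap P) :
    image P (diagonal A) ≤ diagonal (image P A) := by
  rintro _ ⟨x, hx, rfl⟩
  exact ⟨apply_mem_image_self x, hP.apply_star x hx.2 ▸ apply_mem_image_self _⟩

end IsRealPositiveMap

lemma diagonal_image_le {A : Submodule ℂ (H →L[ℂ] H)} {P : A →ₗ[ℂ] A}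
    {S : Submodule ℂ (H →L[ℂ] H)} :
    diagonal (image P S) ≤ diagonal A ⊓ image P S :=
  le_inf (diagonal_mono image_le) diagonal_le

end JordanOA

theorem proposition5p5_general {H : Type*} [NormedAddCommGroup H] [InnerProductSpace ℂ H]
    [CompleteSpace H] {A : Submodule ℂ (H →L[ℂ] H)} {P : A →ₗ[ℂ] A}
    (hproj : ∀ x : A, P (P x) = P x) (hpos : JordanOA.IsRealPositiveMap P) :
    (∀ x : A, (x : H →L[ℂ] H).IsPositive → (P x : H →L[ℂ] H).IsPositive) ∧
    JordanOA.image P (JordanOA.diagonal A) = JordanOA.diagonal (JordanOA.image P A) ∧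
    JordanOA.diagonal (JordanOA.image P A) = JordanOA.diagonal A ⊓ JordanOA.image P A := by
  have image_le_diagonal := hpos.image_diagonal_le_diagonal_image
  have inf_le_image : JordanOA.diagonal A ⊓ JordanOA.image P A ≤
      JordanOA.image P (JordanOA.diagonal A) := JordanOA.inf_image_le_image hproj
  have diagonal_le_inf := JordanOA.diagonal_image_le (P := P) (S := A)
  exact ⟨fun _ => hpos.isPositive_apply,
    le_antisymm image_le_diagonal (diagonal_le_inf.trans inf_le_image),
    le_antisymm diagonal_le_inf (inf_le_image.trans image_le_diagonal)⟩

theorem proposition5p5 {H : Type*} [NormedAddCommGroup H] [InnerProductSpace ℂ H]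
    [CompleteSpace H] (A : Submodule ℂ (H →L[ℂ] H)) (hA : JordanOA.IsJordanOperatorAlgebra A)
    (P : A →ₗ[ℂ] A) (hproj : ∀ x : A, P (P x) = P x) (hcontr : ∀ x : A, ‖P x‖ ≤ ‖x‖)
    (hpos : JordanOA.IsRealPositiveMap P) :
    JordanOA.IsJCStarAlgebra (JordanOA.diagonal A) ∧
    (∀ x : A, (x : H →L[ℂ] H) ∈ JordanOA.diagonal A → (x : H →L[ℂ] H).IsPositive →
      (P x : H →L[ℂ] H).IsPositive) ∧
    JordanOA.image P (JordanOA.diagonal A) = JordanOA.diagonal (JordanOA.image P A) ∧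
    JordanOA.diagonal (JordanOA.image P A) = JordanOA.diagonal A ⊓ JordanOA.image P A := by
  obtain ⟨positive, diagonal_eq⟩ := proposition5p5_general hproj hpos
  exact ⟨hA.isJCStarAlgebra_diagonal, fun x _ => positive x, diagonal_eq⟩
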